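/- Let $p\ge 2$ be an integer and let $\Delta^+=\mathbb{Z}_p*\mathbb{Z}$ be the free product of a cyclic group of order $p$ and an infinite cyclic group. For $n\ge 0$ let $s_f(n)$ be the number of free subgroups of (finite) index $n$ in $\Delta^+$ (so $s_f(0)=0$). A connected rooted $(p,\infty)$-hypermap on $n$ darts consists of permutations $\alpha,\sigma$ of $\{1,\dots,n\}$ such that $\langle\alpha,\sigma\rangle$ acts transitively and all cycles of $\alpha$ have length $p$, together with a marked dart (the root); two of these are isomorphic if a permutation $\psi$ of $\{1,\dots,n\}$ satisfies $\psi\alpha_1\psi^{-1}=\alpha_2$, $\psi\sigma_1\psi^{-1}=\sigma_2$ and maps the first root to the second. Let $\mathfrak{H}^r_p(n)$ be the set of isomorphism classes. Let $H^*(z)=\sum_{n\ge0}h^*_n\frac{z^n}{n!}$ be the exponential generating series of the labelled, not necessarily connected, $(p,\infty)$-hypermaps, i.e. $h^*_n$ is the number of pairs $(\alpha,\sigma)$ of permutations of $\{1,\dots,n\}$ such that all cycles of $\alpha$ have length $p$ (with $h^*_0=1$), and let $$H^\circ(z)=z\,\frac{d}{dz}\log H^*(z)=\frac{z\,\frac{d}{dz}H^*(z)}{H^*(z)}.$$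 Then all $s_f(n)$ are finite, and, as formal power series over $\mathbb{Q}$, the subgroup growth series $S_f(z)=\sum_{n\ge0}s_f(n)z^n$ is equal to the rooted $(p,\infty)$-hypermap series: $$S_f(z)=\sum_{n\ge0}|\mathfrak{H}^r_p(n)|\,z^n=H^\circ(z).$$ -/

import Mathlib

namespace PInftyHypermap

/-- The free product `ℤ_p * ℤ`, written multiplicatively. -/
abbrev FreeProd (p : ℕ) : Type :=
  Monoid.Coprod (Multiplicative (ZMod p)) (Multiplicative ℤ)

/-- The free subgroups of index `n` of `ℤ_p * ℤ`. Since `Subgroup.index` is `0` for subgroups of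
infinite index, finiteness of the index is required separately; so the set is empty for `n = 0`. -/
def freeSubgroups (p n : ℕ) : Set (Subgroup (FreeProd p)) :=
  {Γ | Γ.FiniteIndex ∧ Γ.index = n ∧ IsFreeGroup Γ}

/-- The subgroup growth series `S_f(z) = ∑ s_f(n) z ^ n`. -/
noncomputable def subgroupSeries (p : ℕ) : PowerSeries ℚ :=
  PowerSeries.mk fun n => ((freeSubgroups p n).ncard : ℚ)

/-- All cycles of the permutation `α` have length `p`
(for `p ≥ 2` in particular there are no fixed points). -/
def AllCyclesOfLength {D : Type} (p : ℕ) (α : Equiv.Perm D) : Prop :=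
  ∀ d : D, Function.minimalPeriod α d = p

/-- A connected oriented rooted `(p, ∞)`-hypermap with dart set `Fin n`: permutations `α`, `σ`
generating a transitive group, all cycles of `α` (the hyper-edges) being `p`-gons, together with
a marked dart. -/
structure Rooted (p n : ℕ) where
  α : Equiv.Perm (Fin n)
  σ : Equiv.Perm (Fin n)
  root : Fin n
  transitive : MulAction.IsPretransitive (Subgroup.closure {α, σ}) (Fin n)
  hyperedges : AllCyclesOfLength p α

/-- Isomorphism of rooted hypermaps: a bijection of the darts that conjugates both permutations
and sends root to root. -/
def Rooted.Iso {p n : ℕ} (H₁ H₂ : Rooted p n) : Prop :=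
  ∃ ψ : Equiv.Perm (Fin n), ψ * H₁.α * ψ⁻¹ = H₂.α ∧ ψ * H₁.σ * ψ⁻¹ = H₂.σ ∧ ψ H₁.root = H₂.root

theorem Rooted.iso_equivalence (p n : ℕ) : Equivalence (Rooted.Iso (p := p) (n := n)) where
  refl _ := ⟨1, by simp, by simp, rfl⟩
  symm := by
    rintro _ _ ⟨ψ, h₁, h₂, h₃⟩
    refine ⟨ψ⁻¹, ?_, ?_, ?_⟩
    · rw [← h₁]; group
    · rw [← h₂]; group
    · rw [← h₃]; simp
  trans := by
    rintro _ _ _ ⟨ψ, h₁, h₂, h₃⟩ ⟨χ, k₁, k₂, k₃⟩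
    refine ⟨χ * ψ, ?_, ?_, ?_⟩
    · rw [← k₁, ← h₁]; group
    · rw [← k₂, ← h₂]; group
    · rw [← k₃, ← h₃]; rfl

/-- The set of connected oriented rooted `(p, ∞)`-hypermaps on `n` (unlabelled) darts, that is,
of isomorphism classes of rooted hypermaps with dart set `Fin n`. -/
def RootedClasses (p n : ℕ) : Type :=
  Quotient (⟨Rooted.Iso, Rooted.iso_equivalence p n⟩ : Setoid (Rooted p n))

/-- The rooted hypermap series `∑ |𝔥ʳ_p(n)| z ^ n`. -/
noncomputable def rootedSeries (p : ℕ) : PowerSeries ℚ :=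
  PowerSeries.mk fun n => (Nat.card (RootedClasses p n) : ℚ)

/-- The (exponential) generating series `H^*(z)` of the species of labelled, not necessarily
connected, `(p, ∞)`-hypermaps: pairs `(α, σ)` of permutations of `n` darts such that all cycles
of `α` have length `p`. Its constant term is `1`. -/
noncomputable def labelledSeries (p : ℕ) : PowerSeries ℚ :=
  PowerSeries.mk fun n =>
    (Nat.card {H : Equiv.Perm (Fin n) × Equiv.Perm (Fin n) // AllCyclesOfLength p H.1} : ℚ) /
      (n.factorial : ℚ)

/-- The generating series `H°(z) = z * d/dz (log H^*(z)) = z * (d/dz H^*(z)) / H^*(z)` of the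
species `H° = Z · H'`, where `H^* = E(H)`. -/
noncomputable def circSeries (p : ℕ) : PowerSeries ℚ :=
  PowerSeries.X * PowerSeries.derivative ℚ (labelledSeries p) * (labelledSeries p)⁻¹

end PInftyHypermap

/-!
A rooted `(p, ∞)`-hypermap on `n` darts is a transitive permutation representation of `ℤ_p * ℤ` on
`n` points with a base point, in which no nontrivial element of `ℤ_p` has a fixed point. Up to
isomorphism it is determined by the stabilizer of the base point, a subgroup of index `n`
(`Rooted.iso_iff_stab_eq`), and the subgroups that arise are those that meet all conjugates of `ℤ_p`
trivially. These are exactly the free ones. A free subgroup is torsion-free, hence meets the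
conjugates of `ℤ_p` trivially (`eq_one_of_conj_inl_mem`). Conversely, if `K` acts freely on the
cosets of a subgroup of `K ∗ F`, with `F` free, then the action groupoid is a free groupoid
(`nonempty_isFreeGroupoid_actionCategory`), and the subgroup, being one of its vertex groups, is
free (`isFreeGroup_of_forall_conj_inl`) by the argument behind the Nielsen–Schreier theorem. This
gives the bijection `rootedClassesEquiv`, and with it finiteness and the equality of the subgroup
series with the rooted series.

For the remaining equality, write `h n` for the number of labelled hypermaps and `r k` for the
number of isomorphism classes of rooted ones. A labelled hypermap on `n` darts with a distinguished
dart splits into the component of that dart, which is a rooted hypermap, and an arbitrary hypermap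
on the other darts. As rooted hypermaps have no nontrivial automorphisms, there are `k! * r k` of
them on `k` given darts (`card_rooted`). Hence `n * h n = ∑ k, n.choose k * (k! * r k) * h (n - k)`
(`card_labelled_mul`), which is the identity `z * d/dz H^* = R * H^*` of power series, where `R` is
the rooted series.
-/

namespace PInftyHypermap

/-! ### Free subgroups of a free product `K ∗ F` with `F` free -/

section ActionGroupoid

universe u

open CategoryTheory CategoryTheory.ActionCategory
open scoped Monoid.Coprod

variable {K F A : Type u} [Group K] [Group F]

/-- A choice of a representative `rep a` of the `K`-orbit of each point `a`, together with an element
`t a` of `K` that carries `rep a` to `a`. -/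
theorem exists_transversal (K F A : Type u) [Group K] [Group F] [MulAction (K ∗ F) A] :
    ∃ (rep : A → A) (t : A → K), (∀ a, (Monoid.Coprod.inl (t a) : K ∗ F) • rep a = a) ∧
      ∀ (k : K) a, rep ((Monoid.Coprod.inl k : K ∗ F) • a) = rep a := by
  let _ : MulAction K A := MulAction.compHom A (Monoid.Coprod.inl : K →* K ∗ F)
  have key : ∀ a : A, ∃ k : K, k • (Quotient.mk (MulAction.orbitRel K A) a).out = a := fun a =>
    MulAction.orbitRel_apply.1 ((MulAction.orbitRel K A).symm
      (Quotient.mk_out (s := MulAction.orbitRel K A) a))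
  choose t ht using key
  refine ⟨fun a => (Quotient.mk (MulAction.orbitRel K A) a).out, t, ht, fun k a => ?_⟩
  have : (Quotient.mk (MulAction.orbitRel K A) (k • a)) = Quotient.mk _ a :=
    Quotient.sound (MulAction.orbitRel_apply.2 ⟨k, rfl⟩)
  exact congrArg Quotient.out this

open scoped Classical in
/-- If `K` acts freely on a `K ∗ F`-set and `F` is free, then the action groupoid is free. Its
generating arrows are those given by the free generators of `F`, as for the action of a free group,
and, in each `K`-orbit, one arrow from the representative of the orbit to every other point. The
latter determine the whole restriction to `K`, since a functor from the action groupoid of a free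
action of `K` is a coboundary `h b * (h a)⁻¹` on each orbit. -/
theorem nonempty_isFreeGroupoid_actionCategory [IsFreeGroup F]
    [MulAction (K ∗ F) A] (hK : ∀ (k : K) (a : A), (Monoid.Coprod.inl k : K ∗ F) • a = a → k = 1) :
    Nonempty (IsFreeGroupoid (ActionCategory (K ∗ F) A)) := by
  obtain ⟨rep, t, ht, hrep⟩ := exists_transversal K F A
  have hreprep : ∀ a, rep (rep a) = rep a := fun a => by
    conv_rhs => rw [← ht a]
    rw [hrep]
  have huniq : ∀ (k : K) (a : A), rep a = a → t ((Monoid.Coprod.inl k : K ∗ F) • a) = k := by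
    intro k a ha
    have h1 := ht ((Monoid.Coprod.inl k : K ∗ F) • a)
    rw [hrep, ha] at h1
    have h2 := hK (k⁻¹ * t ((Monoid.Coprod.inl k : K ∗ F) • a)) a (by
      rw [map_mul, mul_smul, h1, map_inv, inv_smul_smul])
    exact (inv_mul_eq_one.1 h2).symm
  -- `e ≠ 1` excludes the identity arrow of a representative, whose label could not be prescribed.
  refine ⟨{
    quiverGenerators := ⟨fun a b =>
      {e : K // (Monoid.Coprod.inl e : K ∗ F) • a.back = b.back ∧ rep a.back = a.back ∧ e ≠ 1} ⊕
        {e : IsFreeGroup.Generators F //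
          (Monoid.Coprod.inr (IsFreeGroup.of e) : K ∗ F) • a.back = b.back}⟩
    of := fun e => Sum.rec (fun e => ⟨Monoid.Coprod.inl e.1, e.2.1⟩)
      (fun e => ⟨Monoid.Coprod.inr (IsFreeGroup.of e.1), e.2⟩) e
    unique_lift := ?_ }⟩
  intro X _ f
  let h : A → X := fun b =>
    if hb : t b ≠ 1 then @f ⟨(), rep b⟩ ⟨(), b⟩ (Sum.inl ⟨t b, ht b, hreprep b, hb⟩) else 1
  have h_rep : ∀ a, rep a = a → h a = 1 := by
    intro a ha
    have := huniq 1 a ha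
    rw [map_one, one_smul] at this
    simp [h, this]
  have h_edge : ∀ (a b : A) (e : K) (h₁ : (Monoid.Coprod.inl e : K ∗ F) • a = b)
      (h₂ : rep a = a) (h₃ : e ≠ 1), h b = @f ⟨(), a⟩ ⟨(), b⟩ (Sum.inl ⟨e, h₁, h₂, h₃⟩) := by
    intro a b e h₁ h₂ h₃
    obtain rfl : t b = e := by rw [← h₁, huniq e a h₂]
    obtain rfl : rep b = a := by rw [← h₁, hrep, h₂]
    exact dif_pos h₃
  let f' : IsFreeGroup.Generators F → (A → X) ⋊[mulAutArrow] (K ∗ F) := fun e =>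
    ⟨fun b => @f ⟨(), _⟩ ⟨(), b⟩ (Sum.inr ⟨e, smul_inv_smul _ b⟩),
      Monoid.Coprod.inr (IsFreeGroup.of e)⟩
  -- The homomorphism that curries the coboundary of `h`: a conjugate of the trivial section.
  let FK : K →* (A → X) ⋊[mulAutArrow] (K ∗ F) :=
    (MulAut.conj (SemidirectProduct.inl h)).toMonoidHom.comp
      (SemidirectProduct.inr.comp Monoid.Coprod.inl)
  have FK_left : ∀ k b, (FK k).left b = h b * (h ((Monoid.Coprod.inl k : K ∗ F)⁻¹ • b))⁻¹ := by
    intro k b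
    simp [FK, MulAut.conj_apply]
    rfl
  have FK_right : ∀ k, (FK k).right = Monoid.Coprod.inl k := by
    intro k
    simp [FK, MulAut.conj_apply]
  rcases IsFreeGroup.unique_lift f' with ⟨FF, hFF, -⟩
  let F' : K ∗ F →* (A → X) ⋊[mulAutArrow] (K ∗ F) := Monoid.Coprod.lift FK FF
  have sane : SemidirectProduct.rightHom.comp F' = MonoidHom.id _ := by
    apply Monoid.Coprod.hom_ext
    · ext k
      simp [F', FK_right]
    · apply IsFreeGroup.ext_hom
      intro x
      simp [F', hFF, f']
  refine ⟨uncurry F' fun g => DFunLike.congr_fun sane g, ?_, ?_⟩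
  · rintro ⟨⟨⟩, a : A⟩ ⟨⟨⟩, b⟩ (⟨e, he : (Monoid.Coprod.inl e : K ∗ F) • a = b,
      ha : rep a = a, he1⟩ | ⟨e, he⟩)
    · change (F' (Monoid.Coprod.inl e)).left b = _
      subst he
      simp only [F', Monoid.Coprod.lift_apply_inl]
      rw [FK_left, inv_smul_smul, h_rep a ha, inv_one, mul_one]
      exact h_edge a _ e rfl ha he1
    · change (F' (Monoid.Coprod.inr (IsFreeGroup.of e))).left b = _
      simp only [F', Monoid.Coprod.lift_apply_inr]
      rw [hFF]
      cases inv_smul_eq_iff.mpr he.symm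
      rfl
  · intro E hE
    have h_curry : ∀ (a b : A) (g : K ∗ F) (hg : g • a = b), (curry E g).left b =
        E.map (show @Quiver.Hom (ActionCategory (K ∗ F) A) _ ⟨(), a⟩ ⟨(), b⟩ from ⟨g, hg⟩) := by
      intro a b g hg
      cases inv_smul_eq_iff.mpr hg.symm
      rfl
    have : curry E = F' := by
      apply Monoid.Coprod.hom_ext
      · have hleft : ∀ b, (curry E (Monoid.Coprod.inl (t b))).left b = h b := by
          intro b
          by_cases hb : t b = 1
          · rw [hb, map_one, map_one, SemidirectProduct.one_left]
            simp [h, hb]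
          · exact ((h_curry (rep b) b _ (ht b)).trans
              (hE ⟨(), rep b⟩ ⟨(), b⟩ (Sum.inl ⟨t b, ht b, hreprep b, hb⟩))).trans
              (h_edge (rep b) b (t b) (ht b) (hreprep b) hb).symm
        ext k
        · rename_i b
          -- The arrow `rep b ⟶ b` is `rep b ⟶ k⁻¹ • b` followed by `k`, so `E` is known on `k`.
          have hk : t b = k * t ((Monoid.Coprod.inl k : K ∗ F)⁻¹ • b) := by
            have hr : rep ((Monoid.Coprod.inl k : K ∗ F)⁻¹ • b) = rep b := by
              rw [← map_inv, hrep]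
            have h1 := ht ((Monoid.Coprod.inl k : K ∗ F)⁻¹ • b)
            rw [← huniq (k * t ((Monoid.Coprod.inl k : K ∗ F)⁻¹ • b)) (rep b) (hreprep b),
              map_mul, mul_smul, ← hr, h1, smul_inv_smul]
          have h2 := hleft b
          rw [hk, map_mul, map_mul, SemidirectProduct.mul_left, Pi.mul_apply] at h2
          have h3 := hleft ((Monoid.Coprod.inl k : K ∗ F)⁻¹ • b)
          simp only [F', MonoidHom.comp_apply, Monoid.Coprod.lift_apply_inl, FK_left]
          rw [← h2, ← h3, eq_mul_inv_iff_mul_eq]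
          rfl
        · simp only [F', MonoidHom.comp_apply, Monoid.Coprod.lift_apply_inl, FK_right]
          rfl
      · apply IsFreeGroup.ext_hom
        intro e
        simp only [F', MonoidHom.comp_apply, Monoid.Coprod.lift_apply_inr, hFF]
        ext
        · convert! hE _ _ (Sum.inr _)
          rfl
        · rfl
    apply Functor.hext
    · intro
      apply Unit.ext
    · refine ActionCategory.cases ?_
      intro b g
      exact heq_of_eq (congrArg (fun φ : K ∗ F →* (A → X) ⋊[mulAutArrow] (K ∗ F) =>
        (φ g).left b) this)

/-- A subgroup that contains no nontrivial conjugate of an element of `K` is free: it is a vertex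
group of the action groupoid of its coset space, on which `K` acts freely. -/
theorem isFreeGroup_of_forall_conj_inl [IsFreeGroup F] (Γ : Subgroup (K ∗ F))
    (hΓ : ∀ (k : K) (g : K ∗ F), g⁻¹ * Monoid.Coprod.inl k * g ∈ Γ → k = 1) : IsFreeGroup Γ := by
  obtain ⟨hfree⟩ := nonempty_isFreeGroupoid_actionCategory (K := K) (F := F) (A := (K ∗ F) ⧸ Γ) (by
    intro k a ha
    induction a using QuotientGroup.induction_on with
    | H g =>
      rw [MulAction.Quotient.smul_mk, eq_comm, QuotientGroup.eq] at ha
      exact hΓ k g (by simpa [mul_assoc] using ha))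
  -- The instances are explicit because the category structure of `ActionCategory` and the one
  -- underlying its groupoid structure agree only after unfolding.
  have hEnd := @IsFreeGroupoid.endIsFreeOfConnectedFree (ActionCategory (K ∗ F) ((K ∗ F) ⧸ Γ)) _
    (inferInstanceAs (@IsConnected (ActionCategory (K ∗ F) ((K ∗ F) ⧸ Γ))
      (instCategoryActionCategory _ _))) hfree (objEquiv (K ∗ F) ((K ∗ F) ⧸ Γ) ↑(1 : K ∗ F))
  let e := endMulEquivSubgroup Γ
  refine @IsFreeGroup.ofMulEquiv _ _ hEnd Γ _ ?_
  exact e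

/-- A free subgroup contains no nontrivial conjugate of an element of a finite `K`, since free groups
are torsion-free. -/
theorem eq_one_of_conj_inl_mem [Finite K] (Γ : Subgroup (K ∗ F)) [IsFreeGroup Γ]
    (k : K) (g : K ∗ F) (hg : g⁻¹ * Monoid.Coprod.inl k * g ∈ Γ) : k = 1 := by
  have : IsMulTorsionFree Γ :=
    (IsFreeGroup.toFreeGroup Γ).injective.isMulTorsionFree (IsFreeGroup.toFreeGroup Γ).toMonoidHom
  have hpow : (g⁻¹ * Monoid.Coprod.inl k * g) ^ Nat.card K = 1 := by
    have := conj_pow (a := g⁻¹) (b := (Monoid.Coprod.inl k : K ∗ F)) (i := Nat.card K)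
    rw [inv_inv] at this
    rw [this, ← map_pow, pow_card_eq_one']
    simp
  have h1 : (⟨_, hg⟩ : Γ) = 1 := by
    refine (pow_eq_one_iff_left (n := Nat.card K) Nat.card_pos.ne').1 (Subtype.ext hpow)
  have h2 : g⁻¹ * Monoid.Coprod.inl k * g = 1 := congrArg Subtype.val h1
  apply Monoid.Coprod.inl_injective (N := F)
  rw [map_one]
  have h3 := conj_eq_one_iff (a := g⁻¹) (b := (Monoid.Coprod.inl k : K ∗ F))
  rw [inv_inv] at h3
  exact h3.1 h2

end ActionGroupoid

/-! ### Rooted hypermaps and free subgroups of finite index -/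

section Correspondence

variable {p n : ℕ}

instance : IsFreeGroup (Multiplicative ℤ) :=
  IsFreeGroup.ofMulEquiv (G := FreeGroup Unit) FreeGroup.mulEquivIntOfUnique

/-- The generator of order `p` of `ℤ_p * ℤ`. -/
def genA (p : ℕ) : FreeProd p := Monoid.Coprod.inl (Multiplicative.ofAdd 1)

/-- The generator of infinite order of `ℤ_p * ℤ`. -/
def genB (p : ℕ) : FreeProd p := Monoid.Coprod.inr (Multiplicative.ofAdd 1)

theorem inl_eq_genA_pow [NeZero p] (k : Multiplicative (ZMod p)) :
    (Monoid.Coprod.inl k : FreeProd p) = genA p ^ (Multiplicative.toAdd k).val := by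
  rw [genA, ← map_pow, ← ofAdd_nsmul]
  simp

theorem inr_eq_genB_zpow (k : Multiplicative ℤ) :
    (Monoid.Coprod.inr k : FreeProd p) = genB p ^ (Multiplicative.toAdd k) := by
  rw [genB, ← map_zpow, ← ofAdd_zsmul]
  simp

theorem genA_pow : genA p ^ p = 1 := by
  rw [genA, ← map_pow, ← ofAdd_nsmul]
  simp

theorem closure_genA_genB [NeZero p] : Subgroup.closure {genA p, genB p} = ⊤ := by
  rw [eq_top_iff, ← Monoid.Coprod.closure_range_inl_union_inr, Subgroup.closure_le]
  rintro _ (⟨k, rfl⟩ | ⟨k, rfl⟩)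
  · rw [inl_eq_genA_pow]
    exact pow_mem (Subgroup.subset_closure (by simp)) _
  · rw [inr_eq_genB_zpow]
    exact zpow_mem (Subgroup.subset_closure (by simp)) _

theorem FreeProd.hom_ext [NeZero p] {G : Type*} [Group G] {f g : FreeProd p →* G}
    (hA : f (genA p) = g (genA p)) (hB : f (genB p) = g (genB p)) : f = g := by
  refine MonoidHom.eq_of_eqOn_dense closure_genA_genB ?_
  rintro _ (rfl | rfl)
  exacts [hA, hB]

theorem FreeProd.range_hom [NeZero p] {G : Type*} [Group G] (f : FreeProd p →* G) :
    f.range = Subgroup.closure {f (genA p), f (genB p)} := by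
  rw [MonoidHom.range_eq_map, ← closure_genA_genB, MonoidHom.map_closure, Set.image_pair]

/-- The homomorphism from `ℤ_p * ℤ` prescribed by the images of the two generators. -/
def FreeProd.homOf {G : Type*} [Group G] (x y : G) (hx : x ^ p = 1) : FreeProd p →* G :=
  Monoid.Coprod.lift
    (AddMonoidHom.toMultiplicativeLeft (ZMod.lift p
      ⟨zmultiplesHom (Additive G) (Additive.ofMul x), by simp [← ofMul_pow, hx]⟩))
    (zpowersHom G y)

theorem FreeProd.homOf_genA {G : Type*} [Group G] (x y : G) (hx : x ^ p = 1) :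
    FreeProd.homOf x y hx (genA p) = x := by
  have := ZMod.lift_coe p (A := Additive G)
    ⟨zmultiplesHom (Additive G) (Additive.ofMul x), by simp [← ofMul_pow, hx]⟩ 1
  rw [Int.cast_one] at this
  simp [homOf, genA, this]

theorem FreeProd.homOf_genB {G : Type*} [Group G] (x y : G) (hx : x ^ p = 1) :
    FreeProd.homOf x y hx (genB p) = y := by
  simp [homOf, genB]

theorem AllCyclesOfLength.pow_eq_one {D : Type} {α : Equiv.Perm D} (h : AllCyclesOfLength p α) :
    α ^ p = 1 := by
  ext d
  have := Function.iterate_minimalPeriod (f := α) (x := d)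
  rw [h d] at this
  simpa [Equiv.Perm.iterate_eq_pow] using this

theorem AllCyclesOfLength.pow_apply_eq_iff {D : Type} {α : Equiv.Perm D}
    (h : AllCyclesOfLength p α) (m : ℕ) (d : D) : (α ^ m) d = d ↔ p ∣ m := by
  rw [← h d, ← Function.isPeriodicPt_iff_minimalPeriod_dvd, Function.IsPeriodicPt,
    Function.IsFixedPt, Equiv.Perm.iterate_eq_pow]

namespace Rooted

/-- The permutation representation of `ℤ_p * ℤ` on the darts of a hypermap. -/
def hom (H : Rooted p n) : FreeProd p →* Equiv.Perm (Fin n) :=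
  FreeProd.homOf H.α H.σ H.hyperedges.pow_eq_one

/-- The stabilizer of the root dart, a subgroup of `ℤ_p * ℤ`. -/
def stab (H : Rooted p n) : Subgroup (FreeProd p) :=
  (MulAction.stabilizer (Equiv.Perm (Fin n)) H.root).comap H.hom

theorem mem_stab (H : Rooted p n) (g : FreeProd p) : g ∈ H.stab ↔ H.hom g H.root = H.root :=
  Iff.rfl

theorem hom_genA (H : Rooted p n) : H.hom (genA p) = H.α := FreeProd.homOf_genA ..

theorem hom_genB (H : Rooted p n) : H.hom (genB p) = H.σ := FreeProd.homOf_genB ..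

theorem exists_hom_apply_root [NeZero p] (H : Rooted p n) (d : Fin n) :
    ∃ g, H.hom g H.root = d := by
  obtain ⟨⟨x, hx⟩, hd⟩ := H.transitive.exists_smul_eq H.root d
  rw [← H.hom_genA, ← H.hom_genB, ← FreeProd.range_hom] at hx
  obtain ⟨g, rfl⟩ := hx
  exact ⟨g, hd⟩

theorem hom_apply_root_eq_iff (H : Rooted p n) (g h : FreeProd p) :
    H.hom g H.root = H.hom h H.root ↔ h⁻¹ * g ∈ H.stab := by
  rw [mem_stab, map_mul, map_inv, Equiv.Perm.mul_apply, Equiv.Perm.inv_eq_iff_eq, eq_comm]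

/-- The darts of a rooted hypermap are the cosets of the stabilizer of the root. -/
noncomputable def quotientStabEquiv [NeZero p] (H : Rooted p n) :
    FreeProd p ⧸ H.stab ≃ Fin n :=
  Equiv.ofBijective
    (Quotient.lift (fun g => H.hom g H.root) fun g h hgh => by
      rw [eq_comm, hom_apply_root_eq_iff]
      exact QuotientGroup.leftRel_apply.1 hgh)
    ⟨by
      rintro ⟨g⟩ ⟨h⟩ hgh
      exact (QuotientGroup.eq.2 ((H.hom_apply_root_eq_iff h g).1 hgh.symm)),
    fun d => (H.exists_hom_apply_root d).elim fun g hg => ⟨QuotientGroup.mk g, hg⟩⟩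

/-- The root stabilizer is free, because no nontrivial power of `α` fixes a dart. -/
theorem stab_mem_freeSubgroups [NeZero p] (H : Rooted p n) : H.stab ∈ freeSubgroups p n := by
  have hidx : H.stab.index = n := by
    rw [Subgroup.index, Nat.card_congr H.quotientStabEquiv, Nat.card_fin]
  refine ⟨⟨?_⟩, hidx, ?_⟩
  · rw [hidx]
    exact H.root.pos.ne'
  · apply isFreeGroup_of_forall_conj_inl
    intro k g hg
    rw [mem_stab, inl_eq_genA_pow, map_mul, map_mul, map_inv, map_pow, hom_genA,
      Equiv.Perm.mul_apply, Equiv.Perm.mul_apply, Equiv.Perm.inv_eq_iff_eq,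
      H.hyperedges.pow_apply_eq_iff] at hg
    have := Nat.eq_zero_of_dvd_of_lt hg (ZMod.val_lt _)
    exact (ZMod.val_eq_zero _).1 this

/-- An isomorphism intertwines the permutation representations. -/
theorem hom_conj [NeZero p] {H₁ H₂ : Rooted p n} {ψ : Equiv.Perm (Fin n)}
    (hα : ψ * H₁.α * ψ⁻¹ = H₂.α) (hσ : ψ * H₁.σ * ψ⁻¹ = H₂.σ) (g : FreeProd p) :
    H₂.hom g = ψ * H₁.hom g * ψ⁻¹ := by
  have : H₂.hom = (MulAut.conj ψ).toMonoidHom.comp H₁.hom := by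
    apply FreeProd.hom_ext <;> simp [hom_genA, hom_genB, hα, hσ]
  rw [this]
  simp

/-- Two rooted hypermaps are isomorphic exactly when their roots have the same stabilizer. Given equal
stabilizers, the isomorphism sends the image of the first root under `g` to the image of the second
root under `g`. -/
theorem iso_iff_stab_eq [NeZero p] (H₁ H₂ : Rooted p n) : H₁.Iso H₂ ↔ H₁.stab = H₂.stab := by
  constructor
  · rintro ⟨ψ, hα, hσ, hr⟩
    ext g
    rw [mem_stab, mem_stab, hom_conj hα hσ, ← hr]
    simp
  · intro h
    choose s hs using H₁.exists_hom_apply_root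
    have hψ : ∀ g, H₂.hom (s (H₁.hom g H₁.root)) H₂.root = H₂.hom g H₂.root := fun g => by
      rw [hom_apply_root_eq_iff, ← h, ← hom_apply_root_eq_iff, hs]
    let ψ : Equiv.Perm (Fin n) := Equiv.ofBijective (fun d => H₂.hom (s d) H₂.root)
      (Finite.injective_iff_bijective.1 fun d e hde => by
        rw [← hs d, ← hs e, hom_apply_root_eq_iff, h, ← hom_apply_root_eq_iff]
        exact hde)
    have hconj : ∀ g, ψ * H₁.hom g * ψ⁻¹ = H₂.hom g := fun g => by
      rw [mul_inv_eq_iff_eq_mul]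
      ext1 d
      obtain ⟨x, rfl⟩ := H₁.exists_hom_apply_root d
      rw [Equiv.Perm.mul_apply, Equiv.Perm.mul_apply, ]
      change ψ ((H₁.hom g * H₁.hom x) H₁.root) = _
      rw [← map_mul]
      exact (hψ _).trans (by rw [map_mul]; exact congrArg (H₂.hom g) (hψ x).symm)
    refine ⟨ψ, ?_, ?_, ?_⟩
    · rw [← hom_genA, ← hom_genA, hconj]
    · rw [← hom_genB, ← hom_genB, hconj]
    · have := hψ 1
      rwa [map_one, map_one] at this

/-- Every free subgroup of index `n` is a root stabilizer: `ℤ_p * ℤ` acts on its cosets, numbered by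
`Fin n` and rooted at the trivial coset, and the subgroup being torsion-free makes all cycles of
`genA p` have length `p`. -/
theorem exists_stab_eq [NeZero p] {Γ : Subgroup (FreeProd p)} (hΓ : Γ ∈ freeSubgroups p n) :
    ∃ H : Rooted p n, H.stab = Γ := by
  obtain ⟨hfin, hidx, hfree⟩ := hΓ
  have e : FreeProd p ⧸ Γ ≃ Fin n := by
    have : Fintype (FreeProd p ⧸ Γ) := Fintype.ofFinite _
    exact Fintype.equivFinOfCardEq (by rw [← Nat.card_eq_fintype_card, ← hidx]; rfl)
  let φ : FreeProd p →* Equiv.Perm (Fin n) :=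
    e.permCongrHom.toMonoidHom.comp (MulAction.toPermHom (FreeProd p) (FreeProd p ⧸ Γ))
  have hφ : ∀ g h, φ g (e (QuotientGroup.mk h)) = e (QuotientGroup.mk (g * h)) := fun g h => by
    simp [φ, Equiv.permCongrHom, Equiv.permCongr_apply]
  let H : Rooted p n :=
    { α := φ (genA p)
      σ := φ (genB p)
      root := e (QuotientGroup.mk 1)
      transitive := by
        rw [← FreeProd.range_hom]
        refine ⟨fun x y => ?_⟩
        obtain ⟨x, rfl⟩ := e.surjective x
        obtain ⟨y, rfl⟩ := e.surjective y
        induction x using QuotientGroup.induction_on with | H g => ?_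
        induction y using QuotientGroup.induction_on with | H h => ?_
        refine ⟨⟨φ (h * g⁻¹), _, rfl⟩, ?_⟩
        exact (hφ _ _).trans (by rw [inv_mul_cancel_right])
      hyperedges := by
        intro d
        obtain ⟨x, rfl⟩ := e.surjective d
        induction x using QuotientGroup.induction_on with | H g => ?_
        have hper : ∀ m : ℕ, Function.IsPeriodicPt (φ (genA p)) m (e (QuotientGroup.mk g)) ↔
            p ∣ m := by
          intro m
          rw [Function.IsPeriodicPt, Function.IsFixedPt, Equiv.Perm.iterate_eq_pow, ← map_pow, hφ,
            e.apply_eq_iff_eq, eq_comm, QuotientGroup.eq, ← mul_assoc]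
          constructor
          · intro h
            rw [genA, ← map_pow] at h
            have := eq_one_of_conj_inl_mem Γ _ _ h
            rw [← ofAdd_nsmul, ofAdd_eq_one, nsmul_one] at this
            exact (ZMod.natCast_eq_zero_iff _ _).1 this
          · rintro ⟨c, rfl⟩
            rw [pow_mul, genA_pow]
            simp
        refine Nat.dvd_antisymm ?_ ?_
        · exact Function.IsPeriodicPt.minimalPeriod_dvd ((hper p).2 dvd_rfl)
        · exact (hper _).1 (Function.isPeriodicPt_minimalPeriod _ _) }
  refine ⟨H, ?_⟩
  have hH : H.hom = φ := FreeProd.hom_ext H.hom_genA H.hom_genB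
  ext g
  rw [mem_stab, hH]
  change φ g (e (QuotientGroup.mk 1)) = e (QuotientGroup.mk 1) ↔ _
  rw [hφ, e.apply_eq_iff_eq, eq_comm, QuotientGroup.eq]
  simp

end Rooted

/-- Rooted hypermaps up to isomorphism correspond to free subgroups of finite index, a hypermap
being sent to the stabilizer of its root. -/
noncomputable def rootedClassesEquiv (p n : ℕ) [NeZero p] :
    RootedClasses p n ≃ freeSubgroups p n :=
  Equiv.ofBijective
    (Quotient.lift (fun H => ⟨H.stab, H.stab_mem_freeSubgroups⟩) fun H₁ H₂ h =>
      Subtype.ext ((H₁.iso_iff_stab_eq H₂).1 h))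
    ⟨by
      rintro ⟨H₁⟩ ⟨H₂⟩ h
      exact Quotient.sound ((H₁.iso_iff_stab_eq H₂).2 (congrArg Subtype.val h)),
    fun ⟨Γ, hΓ⟩ => (Rooted.exists_stab_eq hΓ).elim fun H hH =>
      ⟨Quotient.mk _ H, Subtype.ext hH⟩⟩

instance : Finite (Rooted p n) :=
  Finite.of_injective (fun H => (H.α, H.σ, H.root)) (by
    rintro ⟨⟩ ⟨⟩ h
    simpa using h)

instance : Finite (RootedClasses p n) := Quotient.finite _

theorem finite_freeSubgroups (p n : ℕ) [NeZero p] : (freeSubgroups p n).Finite :=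
  Set.finite_coe_iff.1 (Finite.of_equiv _ (rootedClassesEquiv p n))

theorem subgroupSeries_eq_rootedSeries (p : ℕ) [NeZero p] :
    subgroupSeries p = rootedSeries p := by
  ext n
  simp only [subgroupSeries, rootedSeries, PowerSeries.coeff_mk]
  rw [Nat.card_congr (rootedClassesEquiv p n), Nat.card_coe_set_eq]

end Correspondence

/-! ### Counting labelled hypermaps by the component of a root -/

section LabelledCount

variable {p n : ℕ}

theorem allCyclesOfLength_iff {D : Type} {p : ℕ} {α : Equiv.Perm D} :
    AllCyclesOfLength p α ↔ ∀ d m, (α ^ m) d = d ↔ p ∣ m := by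
  refine ⟨fun h d m => h.pow_apply_eq_iff m d, fun h d => ?_⟩
  have hper : ∀ m : ℕ, Function.IsPeriodicPt α m d ↔ p ∣ m := fun m => by
    rw [← h d, ← Equiv.Perm.iterate_eq_pow]
    rfl
  exact Nat.dvd_antisymm (Function.IsPeriodicPt.minimalPeriod_dvd ((hper p).2 dvd_rfl))
    ((hper _).1 (Function.isPeriodicPt_minimalPeriod _ _))

namespace Rooted

/-- The relabelling of the darts of a rooted hypermap by a permutation. -/
def relabel (H : Rooted p n) (ψ : Equiv.Perm (Fin n)) : Rooted p n where
  α := ψ * H.α * ψ⁻¹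
  σ := ψ * H.σ * ψ⁻¹
  root := ψ H.root
  transitive := by
    have h := MonoidHom.map_closure (MulAut.conj ψ).toMonoidHom {H.α, H.σ}
    rw [Set.image_pair] at h
    simp only [MulEquiv.coe_toMonoidHom, MulAut.conj_apply] at h
    rw [← h]
    refine ⟨fun x y => ?_⟩
    obtain ⟨⟨γ, hγ⟩, hxy⟩ := H.transitive.exists_smul_eq (ψ⁻¹ x) (ψ⁻¹ y)
    refine ⟨⟨_, γ, hγ, rfl⟩, ?_⟩
    change ψ (γ (ψ⁻¹ x)) = y
    rw [show γ (ψ⁻¹ x) = ψ⁻¹ y from hxy, Equiv.Perm.inv_def, Equiv.apply_symm_apply]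
  hyperedges := allCyclesOfLength_iff.2 fun d m => by
    rw [conj_pow, Equiv.Perm.mul_apply, Equiv.Perm.mul_apply, ← Equiv.Perm.eq_inv_iff_eq]
    exact H.hyperedges.pow_apply_eq_iff m _

/-- A rooted hypermap has no nontrivial automorphism, so distinct permutations relabel it
differently. -/
theorem relabel_injective [NeZero p] (H : Rooted p n) : Function.Injective H.relabel := by
  intro ψ χ h
  ext1 d
  obtain ⟨g, rfl⟩ := H.exists_hom_apply_root d
  have h₁ := hom_conj (H₁ := H) (H₂ := H.relabel ψ) (ψ := ψ) rfl rfl g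
  have h₂ := hom_conj (H₁ := H) (H₂ := H.relabel χ) (ψ := χ) rfl rfl g
  have hr : ψ H.root = χ H.root := congrArg Rooted.root h
  have h₃ := congrArg (fun τ => τ (ψ H.root)) h₁
  have h₄ := congrArg (fun τ => τ (χ H.root)) h₂
  simp only [Equiv.Perm.mul_apply, Equiv.Perm.inv_def, Equiv.symm_apply_apply] at h₃ h₄
  rw [← h₃, ← h₄, h, hr]

/-- The isomorphism class of a rooted hypermap. -/
def isoClass (H : Rooted p n) : RootedClasses p n := Quotient.mk _ H

theorem isoClass_eq_iff {H₁ H₂ : Rooted p n} : H₁.isoClass = H₂.isoClass ↔ H₁.Iso H₂ :=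
  ⟨fun h => Quotient.exact h, fun h => Quotient.sound h⟩

theorem isoClass_surjective : Function.Surjective (isoClass : Rooted p n → RootedClasses p n) :=
  Quotient.mk_surjective

end Rooted

/-- Each isomorphism class contains `n!` rooted hypermaps, one for every relabelling of a fixed
representative. -/
theorem card_rooted (p n : ℕ) [NeZero p] :
    Nat.card (Rooted p n) = n.factorial * Nat.card (RootedClasses p n) := by
  choose rep hrep using (Rooted.isoClass_surjective (p := p) (n := n))
  have hb : Function.Bijective fun x : RootedClasses p n × Equiv.Perm (Fin n) =>
      (rep x.1).relabel x.2 := by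
    have hclass : ∀ c ψ, ((rep c).relabel ψ).isoClass = c := fun c ψ => by
      conv_rhs => rw [← hrep c]
      exact (Rooted.isoClass_eq_iff.2 ⟨ψ, rfl, rfl, rfl⟩).symm
    constructor
    · rintro ⟨c, ψ⟩ ⟨d, χ⟩ h
      dsimp only at h
      obtain rfl : c = d := by rw [← hclass c ψ, h, hclass]
      rw [Rooted.relabel_injective _ h]
    · intro H
      obtain ⟨ψ, hα, hσ, hr⟩ := Rooted.isoClass_eq_iff.1 (hrep H.isoClass)
      refine ⟨(H.isoClass, ψ), ?_⟩
      simp only [Rooted.relabel, hα, hσ, hr]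
  rw [← Nat.card_congr (Equiv.ofBijective _ hb), Nat.card_prod, Nat.card_perm, Nat.card_fin,
    mul_comm]

/-- Labelled, not necessarily connected, `(p, ∞)`-hypermaps with dart set `D`. -/
abbrev Labelled (p : ℕ) (D : Type) : Type :=
  {H : Equiv.Perm D × Equiv.Perm D // AllCyclesOfLength p H.1}

/-- The set of darts of the connected component of `r` in the hypermap `H`. -/
def component {D : Type} (H : Equiv.Perm D × Equiv.Perm D) (r : D) : Set D :=
  {d | ∃ γ ∈ Subgroup.closure {H.1, H.2}, γ r = d}

theorem mem_component_self {D : Type} (H : Equiv.Perm D × Equiv.Perm D) (r : D) :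
    r ∈ component H r := ⟨1, one_mem _, rfl⟩

theorem isPretransitive_iff_component_eq_univ {D : Type} (H : Equiv.Perm D × Equiv.Perm D)
    (r : D) : MulAction.IsPretransitive (Subgroup.closure {H.1, H.2}) D ↔
      component H r = Set.univ := by
  rw [MulAction.isPretransitive_iff_base r, Set.eq_univ_iff_forall]
  exact forall_congr' fun d => ⟨fun ⟨γ, h⟩ => ⟨γ.1, γ.2, h⟩, fun ⟨γ, hγ, h⟩ => ⟨⟨γ, hγ⟩, h⟩⟩

/-- Hypermaps with dart set `D` and a root whose component contains all darts. -/
abbrev RootedOn (p : ℕ) (D : Type) : Type :=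
  {x : Labelled p D × D // component x.1.1 x.2 = Set.univ}

/-- On the dart set `Fin n` this is the notion of a rooted hypermap. -/
def rootedEquivRootedOn (p n : ℕ) : Rooted p n ≃ RootedOn p (Fin n) where
  toFun H := ⟨(⟨(H.α, H.σ), H.hyperedges⟩, H.root),
    (isPretransitive_iff_component_eq_univ (H.α, H.σ) _).1 H.transitive⟩
  invFun x := ⟨x.1.1.1.1, x.1.1.1.2, x.1.2,
    (isPretransitive_iff_component_eq_univ _ _).2 x.2, x.1.1.2⟩
  left_inv _ := rfl
  right_inv _ := rfl

section Glue

variable {A B D : Type} (e : A ⊕ B ≃ D)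

/-- The permutation of `D` obtained by glueing permutations of the two parts. -/
def glue : Equiv.Perm A × Equiv.Perm B →* Equiv.Perm D :=
  e.permCongrHom.toMonoidHom.comp (Equiv.Perm.sumCongrHom A B)

theorem glue_inl (γ : Equiv.Perm A × Equiv.Perm B) (a : A) :
    glue e γ (e (Sum.inl a)) = e (Sum.inl (γ.1 a)) := by
  simp [glue, Equiv.permCongrHom, Equiv.permCongr_apply]

theorem glue_inr (γ : Equiv.Perm A × Equiv.Perm B) (b : B) :
    glue e γ (e (Sum.inr b)) = e (Sum.inr (γ.2 b)) := by
  simp [glue, Equiv.permCongrHom, Equiv.permCongr_apply]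

theorem glue_injective : Function.Injective (glue e) :=
  e.permCongrHom.injective.comp Equiv.Perm.sumCongrHom_injective

theorem allCyclesOfLength_glue_iff (α : Equiv.Perm A × Equiv.Perm B) :
    AllCyclesOfLength p (glue e α) ↔ AllCyclesOfLength p α.1 ∧ AllCyclesOfLength p α.2 := by
  simp only [allCyclesOfLength_iff]
  rw [← e.forall_congr_right, Sum.forall]
  simp only [← map_pow, glue_inl, glue_inr, e.apply_eq_iff_eq, Sum.inl.injEq, Sum.inr.injEq,
    Prod.pow_fst, Prod.pow_snd]

theorem component_glue (α σ : Equiv.Perm A × Equiv.Perm B) (r : A) :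
    component (glue e α, glue e σ) (e (Sum.inl r)) =
      (fun a => e (Sum.inl a)) '' component (α.1, σ.1) r := by
  have h₁ := MonoidHom.map_closure (glue e) {α, σ}
  have h₂ := MonoidHom.map_closure (MonoidHom.fst (Equiv.Perm A) (Equiv.Perm B)) {α, σ}
  rw [Set.image_pair] at h₁ h₂
  simp only [MonoidHom.coe_fst] at h₂
  ext d
  simp only [component, ← h₁, ← h₂, Subgroup.mem_map, Set.mem_ofPred_eq, Set.mem_image]
  constructor
  · rintro ⟨_, ⟨γ, hγ, rfl⟩, rfl⟩
    exact ⟨_, ⟨_, ⟨γ, hγ, rfl⟩, rfl⟩, (glue_inl e γ r).symm⟩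
  · rintro ⟨_, ⟨_, ⟨γ, hγ, rfl⟩, rfl⟩, rfl⟩
    exact ⟨_, ⟨γ, hγ, rfl⟩, glue_inl e γ r⟩

/-- A permutation that maps the first part into itself is glued from permutations of the parts. -/
theorem exists_glue_eq [Finite A] [Finite B] {τ : Equiv.Perm D}
    (hτ : ∀ d ∈ Set.range fun a => e (Sum.inl a), τ d ∈ Set.range fun a => e (Sum.inl a)) :
    ∃ γ, glue e γ = τ := by
  obtain ⟨γ, hγ⟩ := Equiv.Perm.mem_sumCongrHom_range_of_perm_mapsTo_inl
    (σ := e.permCongrHom.symm τ) (by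
      rintro _ ⟨a, rfl⟩
      obtain ⟨b, hb⟩ := hτ _ ⟨a, rfl⟩
      refine ⟨b, ?_⟩
      apply e.injective
      rw [show e (Sum.inl b) = τ (e (Sum.inl a)) from hb]
      simp [Equiv.permCongrHom])
  refine ⟨γ, ?_⟩
  change e.permCongrHom (Equiv.Perm.sumCongrHom A B γ) = τ
  rw [hγ, MulEquiv.apply_symm_apply]

theorem map_mem_component {D : Type} {H : Equiv.Perm D × Equiv.Perm D} {r d : D}
    (hd : d ∈ component H r) : H.1 d ∈ component H r ∧ H.2 d ∈ component H r := by
  obtain ⟨γ, hγ, rfl⟩ := hd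
  exact ⟨⟨H.1 * γ, mul_mem (Subgroup.subset_closure (by simp)) hγ, rfl⟩,
    ⟨H.2 * γ, mul_mem (Subgroup.subset_closure (by simp)) hγ, rfl⟩⟩

/-- A hypermap with a root whose component is the first part amounts to a rooted hypermap on the
first part and an arbitrary hypermap on the second. -/
theorem card_component_eq [Finite A] [Finite B] :
    Nat.card {x : Labelled p D × D // component x.1.1 x.2 = Set.range fun a => e (Sum.inl a)} =
      Nat.card (RootedOn p A) * Nat.card (Labelled p B) := by
  rw [← Nat.card_prod]
  let G : RootedOn p A × Labelled p B → Labelled p D × D := fun y =>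
    (⟨(glue e (y.1.1.1.1.1, y.2.1.1), glue e (y.1.1.1.1.2, y.2.1.2)),
      (allCyclesOfLength_glue_iff e _).2 ⟨y.1.1.1.2, y.2.2⟩⟩, e (Sum.inl y.1.1.2))
  have hG : ∀ y, component (G y).1.1 (G y).2 = Set.range fun a => e (Sum.inl a) := fun y => by
    rw [component_glue, y.1.2, Set.image_univ]
  refine (Nat.card_congr (Equiv.ofBijective (fun y => ⟨G y, hG y⟩) ⟨?_, ?_⟩)).symm
  · rintro ⟨⟨⟨⟨⟨α₁, σ₁⟩, h₁⟩, r⟩, hr⟩, ⟨⟨α₂, σ₂⟩, h₂⟩⟩ ⟨⟨⟨⟨⟨β₁, τ₁⟩, k₁⟩, s⟩, hs⟩, ⟨⟨β₂, τ₂⟩, k₂⟩⟩ h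
    simp only [G, Subtype.mk.injEq, Prod.mk.injEq, (glue_injective e).eq_iff, e.apply_eq_iff_eq,
      Sum.inl.injEq] at h
    obtain ⟨⟨⟨rfl, rfl⟩, ⟨rfl, rfl⟩⟩, rfl⟩ := h
    rfl
  · rintro ⟨⟨⟨⟨α, σ⟩, hα⟩, d⟩, hd⟩
    dsimp only at hd
    obtain ⟨α, rfl⟩ := exists_glue_eq e (τ := α) fun d hd' => by
      rw [← hd] at hd' ⊢
      exact (map_mem_component hd').1
    obtain ⟨σ, rfl⟩ := exists_glue_eq e (τ := σ) fun d hd' => by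
      rw [← hd] at hd' ⊢
      exact (map_mem_component hd').2
    obtain ⟨r, rfl⟩ : d ∈ Set.range fun a => e (Sum.inl a) := hd ▸ mem_component_self _ d
    have h := (allCyclesOfLength_glue_iff e α).1 hα
    refine ⟨⟨⟨(⟨(α.1, σ.1), h.1⟩, r), ?_⟩, ⟨(α.2, σ.2), h.2⟩⟩, rfl⟩
    dsimp only at hd ⊢
    rw [component_glue, ← Set.image_univ] at hd
    exact Set.image_injective.2 (e.injective.comp Sum.inl_injective) hd

end Glue

/-- A numbering of the elements of `S` and of its complement. -/
theorem exists_sum_equiv (S : Finset (Fin n)) :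
    ∃ e : Fin S.card ⊕ Fin (n - S.card) ≃ Fin n, (Set.range fun a => e (Sum.inl a)) = S := by
  classical
  have e₁ : Fin S.card ≃ {x // x ∈ S} := S.equivFin.symm
  have e₂ : Fin (n - S.card) ≃ {x // x ∉ S} :=
    (Fintype.equivFinOfCardEq (by simp [Fintype.card_subtype_compl])).symm
  refine ⟨(e₁.sumCongr e₂).trans (Equiv.sumCompl (· ∈ S)), ?_⟩
  ext d
  simp only [Set.mem_range, Equiv.trans_apply, Equiv.sumCongr_apply, Sum.map_inl,
    Equiv.sumCompl_apply_inl]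
  exact ⟨by rintro ⟨a, rfl⟩; exact (e₁ a).2, fun h => ⟨e₁.symm ⟨d, h⟩, by simp⟩⟩

/-- The recursion for the labelled counts, obtained by sorting the pairs of a labelled hypermap and a
dart according to the component of that dart. -/
theorem card_labelled_mul (p n : ℕ) :
    Nat.card (Labelled p (Fin n)) * n = ∑ k ∈ Finset.range (n + 1),
      n.choose k * (Nat.card (Rooted p k) * Nat.card (Labelled p (Fin (n - k)))) := by
  classical
  have hfib : ∀ S : Finset (Fin n), Nat.card {x : Labelled p (Fin n) × Fin n //
      (Set.toFinite (component x.1.1 x.2)).toFinset = S} =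
        Nat.card (Rooted p S.card) * Nat.card (Labelled p (Fin (n - S.card))) := by
    intro S
    obtain ⟨e, he⟩ := exists_sum_equiv S
    rw [Nat.card_congr (rootedEquivRootedOn p S.card), ← card_component_eq e, he]
    refine Nat.card_congr (Equiv.subtypeEquivRight fun x => ?_)
    rw [← Finset.coe_inj, Set.Finite.coe_toFinset]
  have hsum := Finset.sum_powerset_apply_card (x := (Finset.univ : Finset (Fin n)))
    (fun k => Nat.card (Rooted p k) * Nat.card (Labelled p (Fin (n - k))))
  rw [Finset.powerset_univ, Finset.card_univ, Fintype.card_fin] at hsum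
  simp only [smul_eq_mul] at hsum
  rw [← hsum, ← Finset.sum_congr rfl fun S _ => hfib S, ← Nat.card_sigma,
    Nat.card_congr (Equiv.sigmaFiberEquiv _), Nat.card_prod, Nat.card_fin]

/-- The coefficientwise form of `R(z) * H^*(z) = z * d/dz H^*(z)`, where `R(z)` is the rooted
series. -/
theorem coeff_rootedSeries_mul_labelledSeries (p n : ℕ) [NeZero p] :
    PowerSeries.coeff n (rootedSeries p * labelledSeries p) =
      n * PowerSeries.coeff n (labelledSeries p) := by
  rw [PowerSeries.coeff_mul, Finset.Nat.sum_antidiagonal_eq_sum_range_succ_mk]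
  simp only [rootedSeries, labelledSeries, PowerSeries.coeff_mk]
  have h := congrArg (Nat.cast : ℕ → ℚ) (card_labelled_mul p n)
  push_cast at h
  have hn : (n.factorial : ℚ) ≠ 0 := by exact_mod_cast n.factorial_ne_zero
  rw [mul_div_assoc', mul_comm (n : ℚ), h, Finset.sum_div]
  refine Finset.sum_congr rfl fun k hk => ?_
  have hkn : k ≤ n := Nat.lt_succ_iff.1 (Finset.mem_range.1 hk)
  have hk : (k.factorial : ℚ) ≠ 0 := by exact_mod_cast k.factorial_ne_zero
  have hnk : ((n - k).factorial : ℚ) ≠ 0 := by exact_mod_cast (n - k).factorial_ne_zero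
  rw [Nat.cast_choose ℚ hkn, card_rooted]
  push_cast
  field_simp

theorem constantCoeff_labelledSeries (p : ℕ) :
    PowerSeries.constantCoeff (labelledSeries p) = 1 := by
  rw [← PowerSeries.coeff_zero_eq_constantCoeff_apply, labelledSeries, PowerSeries.coeff_mk]
  have : Unique (Labelled p (Fin 0)) :=
    { default := ⟨1, fun d => d.elim0⟩
      uniq := fun _ => Subsingleton.elim _ _ }
  rw [Nat.card_unique]
  simp

theorem rootedSeries_eq_circSeries (p : ℕ) [NeZero p] : rootedSeries p = circSeries p := by
  rw [circSeries, PowerSeries.eq_mul_inv_iff_mul_eq (by simp [constantCoeff_labelledSeries])]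
  ext n
  rw [coeff_rootedSeries_mul_labelledSeries]
  cases n with
  | zero => simp
  | succ n =>
    rw [PowerSeries.coeff_succ_X_mul, PowerSeries.coeff_derivative]
    push_cast
    ring

end LabelledCount
end PInftyHypermap

theorem mainTheorem10 (p : ℕ) (hp : 2 ≤ p) :
    (∀ n : ℕ, (PInftyHypermap.freeSubgroups p n).Finite) ∧
      PInftyHypermap.subgroupSeries p = PInftyHypermap.rootedSeries p ∧
      PInftyHypermap.subgroupSeries p = PInftyHypermap.circSeries p := by
  have : NeZero p := ⟨by lia⟩
  exact ⟨fun n => PInftyHypermap.finite_freeSubgroups p n,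
    PInftyHypermap.subgroupSeries_eq_rootedSeries p,
    (PInftyHypermap.subgroupSeries_eq_rootedSeries p).trans
      (PInftyHypermap.rootedSeries_eq_circSeries p)⟩
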